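/- **Setting.** Let $X\subset\mathbb{R}^{d_1}$ be finite and non-empty and $k\ge 1$. A $k$-clustering of $X$ is a partition $C=(C_1,\dots,C_k)$ of $X$ (parts may be empty); for $S\subseteq X$ put $C|_S=(C_1\cap S,\dots,C_k\cap S)$. The difference of two $k$-clusterings is $$\Delta_X(C,C')=\min_{\sigma}\frac1{|X|}\sum_{i=1}^k|C_i\,\triangle\, C'_{\sigma(i)}|,$$ the minimum being over the permutations $\sigma$ of $\{1,\dots,k\}$. For $f:\mathbb{R}^{d_1}\to\mathbb{R}^{d_2}$, centers $\mu=(\mu_1,\dots,\mu_k)$ in $\mathbb{R}^{d_2}$ and a $k$-clustering $P$ put $$\mathrm{COST}_X(f,\mu)=\frac1{|X|}\sum_{x\in X}\min_i\|f(x)-\mu_i\|_2^2,\qquad \mathrm{COST}_X(f,P)=\frac1{|X|}\sum_{i=1}^k\min_{c}\sum_{x\in P_i}\|f(x)-c\|_2^2 .$$ Let $C^f_X$ be the clustering of $X$ into the cells $\{x\in X:\|f(x)-\mu_i\|_2\le\|f(x)-\mu_j\|_2\ \forall j\}$ of an optimal $\mu$, i.e. one that minimizes $\mathrm{COST}_X(f,\cdot)$.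 The mapping $f$ is *$(\eta,\varepsilon)$-unique on $X$* if $C^f_X$ is a partition that is the same, up to numbering, for all optimal $\mu$, and every $k$-clustering $P$ of $X$ with $\mathrm{COST}_X(f,P)<\mathrm{COST}_X(f,C^f_X)+\eta$ satisfies $\Delta_X(C^f_X,P)<\varepsilon$. **Statement.** There is an absolute constant $K>0$ such that the following holds for all $k\ge1$, all $d_1,d_2$, every non-empty set $\mathcal F$ of linear maps $\mathbb{R}^{d_1}\to\mathbb{R}^{d_2}$, all $\eta>0$ and all $\varepsilon\in(0,1)$. There is a learner $A$ (which knows $X$, receives a sample $S\subseteq X$ and its clustering, and outputs a member of $\mathcal F$) such that for all $\theta\in(0,1]$ and $\delta\in(0,1)$ there is a sample size $m\in\mathbb{N}$ with $$m\ \le\ K\,\frac{(k+d_1d_2)\,\log\!\left(2+k+\tfrac1\eta\right)+\log\frac1\delta}{(\theta\varepsilon)^2}$$ and with this property: for every finite non-empty $X\subset\mathbb{R}^{d_1}$ such that every $f\in\mathcal F$ maps $X$ into $(0,1)^{d_2}$ and is $(\eta,\varepsilon)$-unique on $X$, for every $k$-clustering $C^*$ of $X$ and every $s\ge m$, if $S$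 is a uniformly random $s$-element subset of $X$ and $f_A=A(X,S,C^*|_S)$, then with probability at least $1-\delta$ $$\Delta_X(C^*,C^{f_A}_X)\ \le\ \inf_{f\in\mathcal F}\Delta_X(C^*,C^f_X)+(1+\theta)\,\varepsilon .$$ In particular, with $\theta=1$, the PAC-SRLK sample complexity of $\mathcal F$ at accuracy $2\varepsilon$ and confidence $\delta$ is $O\big((k+d_1d_2+\log\frac1\delta)/\varepsilon^2\big)$, where $O$ hides a logarithmic factor in $k$ and $\frac1\eta$. -/

import Mathlib

open scoped symmDiff

noncomputable section

namespace SRLK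

/-- The Euclidean space `ℝ^d`. -/
abbrev Euc (d : ℕ) : Type := EuclideanSpace ℝ (Fin d)

variable {α : Type*}

/-- `C = (C_1, …, C_k)` is a partition of the finite set `X` into `k` subsets.
Parts may be empty, as happens for the clustering induced on a small sample. -/
def IsClustering {k : ℕ} (X : Finset α) (C : Fin k → Finset α) : Prop :=
  (∀ i j, i ≠ j → Disjoint (C i) (C j)) ∧ ∀ x, x ∈ X ↔ ∃ i, x ∈ C i

open Classical in
/-- The clustering induced on a sample `S`. -/
def restrict {k : ℕ} (C : Fin k → Finset α) (S : Finset α) : Fin k → Finset α :=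
  fun i => C i ∩ S

open Classical in
/-- The clustering difference
`Δ_X(C, C') = min_σ |X|⁻¹ ∑_i |C_i ∆ C'_{σ i}|`, over all permutations `σ` of the indices. -/
def clusteringDiff {k : ℕ} (X : Finset α) (C C' : Fin k → Finset α) : ℝ :=
  ⨅ σ : Equiv.Perm (Fin k), (1 / (X.card : ℝ)) * ∑ i, (((C i) ∆ (C' (σ i))).card : ℝ)

/-- The k-means cost of a vector of centers `μ`. -/
def centerCost {k d : ℕ} (X : Finset α) (f : α → Euc d) (μ : Fin k → Euc d) : ℝ :=
  (1 / (X.card : ℝ)) * ∑ x ∈ X, ⨅ i : Fin k, ‖f x - μ i‖ ^ 2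

/-- The k-means cost of a clustering, each part being served by its own best center. -/
def clusteringCost {k d : ℕ} (X : Finset α) (f : α → Euc d) (C : Fin k → Finset α) : ℝ :=
  (1 / (X.card : ℝ)) * ∑ i, ⨅ c : Euc d, ∑ x ∈ C i, ‖f x - c‖ ^ 2

open Classical in
/-- The clustering of `X` defined by `f` and the Voronoi cells of the centers `μ`. -/
def voronoi {k d : ℕ} (X : Finset α) (f : α → Euc d) (μ : Fin k → Euc d) :
    Fin k → Finset α :=
  fun i => X.filter fun x => ∀ j, ‖f x - μ i‖ ≤ ‖f x - μ j‖

/-- `μ` minimizes the k-means cost over all vectors of `k` centers. -/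
def IsOptimalCenters {k d : ℕ} (X : Finset α) (f : α → Euc d) (μ : Fin k → Euc d) : Prop :=
  ∀ ν : Fin k → Euc d, centerCost X f μ ≤ centerCost X f ν

/-- A minimizer of the k-means cost. -/
def optimalCenters (k : ℕ) {d : ℕ} (X : Finset α) (f : α → Euc d) : Fin k → Euc d :=
  Classical.epsilon fun μ => IsOptimalCenters X f μ

/-- The k-means clustering `C^f_X` of `X` under the mapping `f`. -/
def kmeans (k : ℕ) {d : ℕ} (X : Finset α) (f : α → Euc d) : Fin k → Finset α :=
  voronoi X f (optimalCenters k X f)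

/-- k-means clustering of `X` under `f` has an `(η, ε)`-unique solution: the optimal solution is
a partition which is unique up to the numbering of its parts, and every partition whose cost is
less than the optimal one plus `η` is `ε`-close to it. -/
def IsUnique (k : ℕ) {d : ℕ} (X : Finset α) (f : α → Euc d) (η ε : ℝ) : Prop :=
  IsClustering X (kmeans k X f) ∧
  (∀ μ : Fin k → Euc d, IsOptimalCenters X f μ →
    ∃ σ : Equiv.Perm (Fin k), ∀ i, voronoi X f μ i = kmeans k X f (σ i)) ∧
  ∀ P : Fin k → Finset α, IsClustering X P →
    clusteringCost X f P < clusteringCost X f (kmeans k X f) + η →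
    clusteringDiff X (kmeans k X f) P < ε

/-- A (transductive) representation learner with values in linear maps: it knows the domain set
and receives a sample together with the clustering of that sample. -/
abbrev Learner (k d₁ d₂ : ℕ) : Type :=
  (X S : Finset (Euc d₁)) → (Fin k → Finset (Euc d₁)) → (Euc d₁ →ₗ[ℝ] Euc d₂)

open Classical in
/-- The learner `A` always outputs a member of `F` and, on every domain set `X` of the family `𝒳`
and for every target `k`-clustering `C` of `X`, a uniformly random `s`-element subset `S` of `X`
with `s ≥ m` yields, with probability at least `1 - δ`, a mapping whose k-means clustering is
within `ε` of the best one in `F`. -/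
def IsPACSRLK {k d₁ d₂ : ℕ} (F : Set (Euc d₁ →ₗ[ℝ] Euc d₂)) (𝒳 : Set (Finset (Euc d₁)))
    (A : Learner k d₁ d₂) (ε δ : ℝ) (m : ℕ) : Prop :=
  (∀ X S Y, A X S Y ∈ F) ∧
  ∀ X ∈ 𝒳, ∀ C : Fin k → Finset (Euc d₁), IsClustering X C → ∀ s : ℕ, m ≤ s →
    (1 - δ) * ((X.powersetCard s).card : ℝ) ≤
      (((X.powersetCard s).filter fun S =>
        clusteringDiff X C (kmeans k X (A X S (restrict C S))) ≤
          (⨅ f : F, clusteringDiff X C (kmeans k X f.1)) + ε).card : ℝ)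

/-- The finite non-empty domain sets which all members of `F` map into the cube `(0,1)^{d₂}` and
on which all of them are `(η, ε)`-unique. -/
def domains (k : ℕ) {d₁ d₂ : ℕ} (F : Set (Euc d₁ →ₗ[ℝ] Euc d₂)) (η ε : ℝ) :
    Set (Finset (Euc d₁)) :=
  {X | X.Nonempty ∧
    ∀ f ∈ F, (∀ x ∈ X, ∀ i, f x i ∈ Set.Ioo (0 : ℝ) 1) ∧ IsUnique k X f η ε}

end SRLK

end

/-!
The learner minimizes the empirical clustering difference over a finite net `T` of `F`, which
depends on the domain set `X`, known to the learner, and on `η`, `ε`, but not on the accuracy `θ`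
or the confidence `δ`. Two facts make this work.

*The k-means clusterings of `F` have a net of radius `ε` with
`log |T| ≤ 14 (k + d₁ d₂) log (2 + k + 1/η)`* (`exists_net_kmeans`). By uniqueness it suffices that
the clustering of `g` has cost less than the optimum plus `η` under `f`. On a finite-dimensional
space of functions on `X` with the supremum norm a volume argument bounds the size of a net
(`exists_sup_net`). Taking the coordinates of the mappings themselves, a space of dimension
`d₁ d₂`, requires precision of order `η / d₂` and costs a factor `log (d₂ / η)`, which is harmless
only if `d₂ ≤ k` (or `d₁ = 0`). For `d₂ > k` and `d₁ ≥ 1` the `k` affine functions `x ↦ ‖μ_i‖² - 2⟪f x, μ_i⟫` are used instead,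
where `μ` are optimal centers in the unit cube. They determine the Voronoi cells, they are bounded
by `d₂`, precision `η / 4` is enough, and they live in dimension
`k (d₁ + 1) ≤ 2 k d₁`; since `k log d₂` is at most of order `d₂ log (2 + k)`, the bound follows
(`log_power_le`).

*Restricting to a random `s`-subset `S` changes the difference to a fixed clustering by more than
`t` with probability at most `2 k! exp (-s t² / 8)`.* For a fixed renumbering of the parts the
difference is the mean of a function with values in `[0, 2]` (`mismatch`), and the `k!` renumberings
are handled by a union bound. Sampling is without replacement: the exponential moment of
a sample sum is then a normalized elementary symmetric polynomial of the numbers `exp (l * g x)`, and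
Maclaurin's inequality (`sum_prod_powersetCard_le`) bounds it by the value for sampling with
replacement, so that Chernoff's method applies.

A union bound over `T` with `t = θ ε / 2` shows that the empirical minimizer is within `θ ε` of the
best member of `T`, which is within `ε` of the infimum over `F`
(`clusteringDiff_le_iInf_add`).
-/

/-! ### Nets in finite-dimensional spaces of bounded functions -/

/-- A family of `α`-separated vectors in the ball of radius `R` of a `d`-dimensional space has at
most `(1 + 2R/α)^d` members: the balls of radius `α/2` around them are disjoint and lie in the ball
of radius `R + α/2`. -/
theorem card_le_of_separated_in_ball {ι E : Type*} [NormedAddCommGroup E] [NormedSpace ℝ E]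
    [FiniteDimensional ℝ E] (T : Finset ι) (v : ι → E) {R α : ℝ} (hR : 0 ≤ R) (hα : 0 < α)
    (hv : ∀ i ∈ T, ‖v i‖ ≤ R) (hsep : ∀ i ∈ T, ∀ j ∈ T, i ≠ j → α ≤ ‖v i - v j‖) :
    (T.card : ℝ) ≤ (1 + 2 * R / α) ^ Module.finrank ℝ E := by
  borelize E
  let μ : MeasureTheory.Measure E := MeasureTheory.Measure.addHaar
  set d := Module.finrank ℝ E
  have hα2 : 0 < α / 2 := by positivity
  have hρ : 0 < R + α / 2 := by positivity
  have hdisj : (T : Set ι).PairwiseDisjoint fun i => Metric.ball (v i) (α / 2) := by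
    intro i hi j hj hij
    apply Metric.ball_disjoint_ball
    rw [dist_eq_norm]
    linarith [hsep i hi j hj hij]
  have hsub : (⋃ i ∈ T, Metric.ball (v i) (α / 2)) ⊆ Metric.ball (0 : E) (R + α / 2) := by
    refine Set.iUnion₂_subset fun i hi => Metric.ball_subset_ball' ?_
    rw [dist_zero_right]
    linarith [hv i hi]
  have hvol : (T.card : ENNReal) * ENNReal.ofReal ((α / 2) ^ d) * μ (Metric.ball 0 1) ≤
      ENNReal.ofReal ((R + α / 2) ^ d) * μ (Metric.ball 0 1) :=
    calc
      _ = μ (⋃ i ∈ T, Metric.ball (v i) (α / 2)) := by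
        rw [MeasureTheory.measure_biUnion_finset hdisj fun _ _ => measurableSet_ball]
        simp only [μ.addHaar_ball_of_pos _ hα2, Finset.sum_const, nsmul_eq_mul, mul_assoc, d]
      _ ≤ μ (Metric.ball (0 : E) (R + α / 2)) := MeasureTheory.measure_mono hsub
      _ = _ := by simp only [μ.addHaar_ball_of_pos _ hρ, d]
  have hcard : (T.card : ENNReal) * ENNReal.ofReal ((α / 2) ^ d) ≤
      ENNReal.ofReal ((R + α / 2) ^ d) :=
    (ENNReal.mul_le_mul_iff_left (Metric.measure_ball_pos _ _ zero_lt_one).ne'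
      MeasureTheory.measure_ball_lt_top.ne).1 hvol
  have hreal : (T.card : ℝ) * (α / 2) ^ d ≤ (R + α / 2) ^ d := by
    have := ENNReal.toReal_le_of_le_ofReal (pow_nonneg hρ.le _) hcard
    simpa [ENNReal.toReal_mul, ENNReal.toReal_ofReal, hα2.le, hα.le] using this
  have hfac : R + α / 2 = (1 + 2 * R / α) * (α / 2) := by field_simp; ring
  rw [hfac, mul_pow] at hreal
  exact le_of_mul_le_mul_right hreal (by positivity)

/-- A family of functions on a finite set, bounded by `R` and lying in a space of dimension at
most `D`, has an internal `α`-net in the supremum norm with at most `(1 + 2R/α)^D` members. -/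
theorem exists_sup_net {ι Y : Type*} [Finite Y] (V : Submodule ℝ (Y → ℝ)) {D : ℕ}
    (hD : Module.finrank ℝ V ≤ D) (Φ : ι → Y → ℝ) (hΦ : ∀ i, Φ i ∈ V) {R α : ℝ} (hR : 0 ≤ R)
    (hα : 0 < α) (hb : ∀ i y, |Φ i y| ≤ R) :
    ∃ T : Finset ι, (T.card : ℝ) ≤ (1 + 2 * R / α) ^ D ∧
      ∀ i, ∃ t ∈ T, ∀ y, |Φ i y - Φ t y| ≤ α := by
  classical
  have := Fintype.ofFinite Y
  let v : ι → V := fun i => ⟨Φ i, hΦ i⟩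
  let Sep : Finset ι → Prop := fun T => ∀ i ∈ T, ∀ j ∈ T, i ≠ j → α ≤ ‖v i - v j‖
  have hcard : ∀ T, Sep T → (T.card : ℝ) ≤ (1 + 2 * R / α) ^ D := fun T hT =>
    (card_le_of_separated_in_ball T v hR hα
      (fun i _ => (pi_norm_le_iff_of_nonneg hR).2 fun y => hb i y) hT).trans
      (pow_le_pow_right₀ (by have : 0 ≤ 2 * R / α := by positivity
                             linarith) hD)
  -- A separated family of largest cardinality is a net.
  let A : Set ℕ := {n | ∃ T, Sep T ∧ T.card = n}
  have hA : A.Nonempty := ⟨0, ∅, by simp [Sep], rfl⟩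
  have hAb : BddAbove A := by
    refine ⟨⌊(1 + 2 * R / α) ^ D⌋₊, ?_⟩
    rintro _ ⟨T, hT, rfl⟩
    exact Nat.le_floor (hcard T hT)
  obtain ⟨T, hT, hTmax⟩ := Nat.sSup_mem hA hAb
  refine ⟨T, hcard T hT, fun i => ?_⟩
  by_contra! hcon
  have hfar : ∀ t ∈ T, α ≤ ‖v i - v t‖ := by
    intro t ht
    obtain ⟨y, hy⟩ := hcon t ht
    exact hy.le.trans (norm_le_pi_norm (Φ i - Φ t) y)
  have hi : i ∉ T := fun hi => by
    have := hfar i hi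
    simp at this
    linarith
  have hins : Sep (insert i T) := by
    intro a ha b hb hab
    rcases Finset.mem_insert.1 ha with hai | haT <;> rcases Finset.mem_insert.1 hb with hbi | hbT
    · exact absurd (hai.trans hbi.symm) hab
    · rw [hai]; exact hfar b hbT
    · rw [hbi, norm_sub_rev]; exact hfar a haT
    · exact hT a haT b hbT hab
  have := le_csSup hAb ⟨_, hins, rfl⟩
  rw [Finset.card_insert_of_notMem hi, hTmax] at this
  omega

/-! ### Sampling without replacement -/

open Finset in
/-- Moving one element `y` out of an `(s+1)`-subset. -/
theorem sum_powersetCard_succ_erase {α : Type*} [DecidableEq α] (X : Finset α) (s : ℕ)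
    (φ : Finset α → α → ℝ) :
    ∑ S ∈ X.powersetCard (s + 1), ∑ y ∈ S, φ (S.erase y) y =
      ∑ R ∈ X.powersetCard s, ∑ y ∈ X \ R, φ R y := by
  rw [sum_sigma', sum_sigma']
  refine sum_bij' (fun p _ => ⟨p.1.erase p.2, p.2⟩) (fun p _ => ⟨insert p.2 p.1, p.2⟩) ?_ ?_ ?_ ?_ ?_
  · rintro ⟨S, y⟩ h
    simp only [mem_sigma, mem_powersetCard, mem_sdiff] at h ⊢
    obtain ⟨⟨hS, hc⟩, hy⟩ := h
    exact ⟨⟨(erase_subset _ _).trans hS, by rw [card_erase_of_mem hy]; omega⟩, hS hy,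
      notMem_erase _ _⟩
  · rintro ⟨R, y⟩ h
    simp only [mem_sigma, mem_powersetCard, mem_sdiff] at h ⊢
    obtain ⟨⟨hR, hc⟩, hy, hyR⟩ := h
    exact ⟨⟨insert_subset hy hR, by rw [card_insert_of_notMem hyR, hc]⟩, mem_insert_self _ _⟩
  · rintro ⟨S, y⟩ h
    simp only [mem_sigma] at h
    simp [insert_erase h.2]
  · rintro ⟨R, y⟩ h
    simp only [mem_sigma, mem_sdiff] at h
    simp [erase_insert h.2.2]
  · rintro ⟨S, y⟩ _
    rfl

open Finset in
/-- One step of Maclaurin's inequality for the elementary symmetric polynomials `e_s` of a family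
of non-negative numbers, with cleared denominators. -/
theorem maclaurin_step {α : Type*} (X : Finset α) (a : α → ℝ)
    (ha : ∀ x ∈ X, 0 ≤ a x) (s : ℕ) (hs : s < X.card) :
    (X.card : ℝ) * ((s + 1) * ∑ S ∈ X.powersetCard (s + 1), ∏ x ∈ S, a x) ≤
      (X.card - s) * ((∑ S ∈ X.powersetCard s, ∏ x ∈ S, a x) * ∑ x ∈ X, a x) := by
  classical
  -- `(s + 1) e_{s+1}` counts every product over an `(s+1)`-set once for each of its elements.
  have h1 : ((s : ℝ) + 1) * ∑ S ∈ X.powersetCard (s + 1), ∏ x ∈ S, a x =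
      ∑ R ∈ X.powersetCard s, (∏ x ∈ R, a x) * ∑ y ∈ X \ R, a y := by
    have := sum_powersetCard_succ_erase X s fun R y => (∏ x ∈ R, a x) * a y
    simp only [← mul_sum] at this
    rw [← this, mul_sum]
    refine sum_congr rfl fun S hS => ?_
    rw [sum_congr rfl fun y hy => prod_erase_mul S a hy, sum_const, nsmul_eq_mul,
      (mem_powersetCard.1 hS).2]
    push_cast; rfl
  have hsplit : (∑ S ∈ X.powersetCard s, ∏ x ∈ S, a x) * ∑ x ∈ X, a x =
      ∑ R ∈ X.powersetCard s, (∏ x ∈ R, a x) * ∑ y ∈ X \ R, a y +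
      ∑ R ∈ X.powersetCard s, (∏ x ∈ R, a x) * ∑ y ∈ R, a y := by
    rw [sum_mul, ← sum_add_distrib]
    refine sum_congr rfl fun R hR => ?_
    rw [← mul_add, sum_sdiff (mem_powersetCard.1 hR).1]
  suffices h : (s : ℝ) * ∑ R ∈ X.powersetCard s, (∏ x ∈ R, a x) * ∑ y ∈ X \ R, a y ≤
      (X.card - s) * ∑ R ∈ X.powersetCard s, (∏ x ∈ R, a x) * ∑ y ∈ R, a y by
    rw [h1, hsplit]; nlinarith
  obtain _ | r := s
  · simp
  -- Both sums are rewritten over `r`-sets; then Cauchy-Schwarz on each complement.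
  have h2 : ∑ R ∈ X.powersetCard (r + 1), (∏ x ∈ R, a x) * ∑ y ∈ R, a y =
      ∑ R ∈ X.powersetCard r, (∏ x ∈ R, a x) * ∑ y ∈ X \ R, a y ^ 2 := by
    have := sum_powersetCard_succ_erase X r fun R y => (∏ x ∈ R, a x) * a y ^ 2
    simp only [← mul_sum] at this
    rw [← this]
    refine sum_congr rfl fun S hS => ?_
    rw [mul_sum]
    refine sum_congr rfl fun y hy => ?_
    rw [← prod_erase_mul S a hy]; ring
  have h3 : ((r : ℝ) + 1) * ∑ R ∈ X.powersetCard (r + 1), (∏ x ∈ R, a x) * ∑ y ∈ X \ R, a y =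
      ∑ R ∈ X.powersetCard r, (∏ x ∈ R, a x) *
        ((∑ y ∈ X \ R, a y) ^ 2 - ∑ y ∈ X \ R, a y ^ 2) := by
    have := sum_powersetCard_succ_erase X r
      fun R y => (∏ x ∈ R, a x) * (a y * ((∑ z ∈ X \ R, a z) - a y))
    refine Eq.trans ?_ (this.trans ?_)
    · rw [mul_sum]
      refine sum_congr rfl fun S hS => ?_
      have hterm : ∀ y ∈ S, (∏ x ∈ S.erase y, a x) * (a y * ((∑ z ∈ X \ S.erase y, a z) - a y)) =
          (∏ x ∈ S, a x) * ∑ z ∈ X \ S, a z := by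
        intro y hy
        have hyX : y ∈ X := (mem_powersetCard.1 hS).1 hy
        rw [sdiff_erase hyX, sum_insert (by simp [hy]), ← prod_erase_mul S a hy]
        ring
      rw [sum_congr rfl hterm, sum_const, nsmul_eq_mul, (mem_powersetCard.1 hS).2]
      push_cast; rfl
    · refine sum_congr rfl fun R hR => ?_
      rw [← mul_sum]
      congr 1
      simp only [mul_sub, sum_sub_distrib, ← sum_mul, ← sq]
  push_cast
  rw [h3, h2, mul_sum]
  refine sum_le_sum fun R hR => ?_
  obtain ⟨hRX, hRc⟩ := mem_powersetCard.1 hR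
  have hprod : 0 ≤ ∏ x ∈ R, a x := prod_nonneg fun x hx => ha x (hRX hx)
  have hcs := sq_sum_le_card_mul_sum_sq (s := X \ R) (f := a)
  rw [card_sdiff_of_subset hRX, hRc, Nat.cast_sub (by omega)] at hcs
  nlinarith [mul_le_mul_of_nonneg_left hcs hprod]

open Finset in
/-- Maclaurin's inequality between the first and the `s`-th symmetric mean. For `a = exp ∘ g` it
says that sampling without replacement has no larger exponential moments than sampling with
replacement. -/
theorem sum_prod_powersetCard_le {α : Type*} (X : Finset α) (a : α → ℝ)
    (ha : ∀ x ∈ X, 0 ≤ a x) (s : ℕ) :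
    ∑ S ∈ X.powersetCard s, ∏ x ∈ S, a x ≤
      ((X.powersetCard s).card : ℝ) * ((1 / (X.card : ℝ)) * ∑ x ∈ X, a x) ^ s := by
  induction s with
  | zero => simp
  | succ s ih =>
    rcases le_or_gt X.card s with hs | hs
    · simp [powersetCard_eq_empty.2 (Nat.lt_succ_of_le hs)]
    have hn : (0 : ℝ) < X.card := by exact_mod_cast (Nat.zero_le s).trans_lt hs
    have hsn : (s : ℝ) < X.card := by exact_mod_cast hs
    have hstep := maclaurin_step X a ha s hs
    have hA : 0 ≤ ∑ x ∈ X, a x := sum_nonneg ha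
    have hchoose : ((X.card.choose (s + 1) : ℕ) : ℝ) * (s + 1) =
        (X.card.choose s : ℕ) * (X.card - s) := by
      have := Nat.choose_succ_right_eq X.card s
      rw [← Nat.cast_sub hs.le]
      exact_mod_cast this
    rw [card_powersetCard] at ih ⊢
    set m := (1 / (X.card : ℝ)) * ∑ x ∈ X, a x with hm
    have hAm : ∑ x ∈ X, a x = X.card * m := by
      rw [hm, ← mul_assoc, mul_one_div_cancel hn.ne', one_mul]
    rw [hAm] at hstep hA
    have hpos : (0 : ℝ) < X.card * (s + 1) := mul_pos hn (by exact_mod_cast Nat.succ_pos s)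
    refine le_of_mul_le_mul_left ?_ hpos
    calc (X.card : ℝ) * (s + 1) * ∑ S ∈ X.powersetCard (s + 1), ∏ x ∈ S, a x
        ≤ (X.card - s) * ((∑ S ∈ X.powersetCard s, ∏ x ∈ S, a x) * (X.card * m)) := by
          rw [mul_assoc]; exact hstep
      _ ≤ (X.card - s) * (((X.card.choose s : ℕ) : ℝ) * m ^ s * (X.card * m)) := by
          have : (0 : ℝ) ≤ X.card - s := by linarith
          exact mul_le_mul_of_nonneg_left (mul_le_mul_of_nonneg_right ih hA) this
      _ = X.card * m ^ (s + 1) * ((X.card.choose s : ℕ) * (X.card - s)) := by ring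
      _ = X.card * (s + 1) * ((X.card.choose (s + 1) : ℕ) * m ^ (s + 1)) := by
          rw [← hchoose]; ring

open Real Finset in
/-- Exponential moments of a function with values in `[0, 2]` under the uniform distribution, by
symmetrization: with an independent copy `y` of `x`, Jensen's inequality bounds
`𝔼 exp (l (g x - 𝔼 g))` by `𝔼 exp (l (g x - g y)) = 𝔼 cosh (l (g x - g y))`. -/
theorem mean_exp_le {α : Type*} (X : Finset α) (hX : X.Nonempty) (g : α → ℝ)
    (hg : ∀ x ∈ X, g x ∈ Set.Icc (0 : ℝ) 2) (l : ℝ) :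
    (1 / (X.card : ℝ)) * ∑ x ∈ X, exp (l * g x) ≤
      exp (l * ((1 / (X.card : ℝ)) * ∑ x ∈ X, g x) + 2 * l ^ 2) := by
  have hn : (0 : ℝ) < X.card := by exact_mod_cast hX.card_pos
  set m := (1 / (X.card : ℝ)) * ∑ x ∈ X, g x with hm
  have hjensen : exp (-(l * m)) ≤ (1 / (X.card : ℝ)) * ∑ y ∈ X, exp (-(l * g y)) := by
    have := convexOn_exp.map_sum_le (t := X) (w := fun _ => 1 / (X.card : ℝ))
      (p := fun y => -(l * g y)) (fun _ _ => by positivity) (by simp [hn.ne'])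
      (fun _ _ => Set.mem_univ _)
    simp only [smul_eq_mul, ← mul_sum] at this
    refine le_of_eq_of_le ?_ this
    congr 1
    rw [hm, sum_neg_distrib, ← mul_sum]
    ring
  have hdouble : ∑ x ∈ X, ∑ y ∈ X, exp (l * g x) * exp (-(l * g y)) =
      ∑ x ∈ X, ∑ y ∈ X, cosh (l * (g x - g y)) := by
    have hswap : ∑ x ∈ X, ∑ y ∈ X, exp (l * g x) * exp (-(l * g y)) =
        ∑ x ∈ X, ∑ y ∈ X, exp (l * g y) * exp (-(l * g x)) := sum_comm
    have hcosh : ∀ x y, cosh (l * (g x - g y)) =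
        (exp (l * g x) * exp (-(l * g y)) + exp (l * g y) * exp (-(l * g x))) / 2 := by
      intro x y
      rw [cosh_eq, ← exp_add, ← exp_add]
      ring_nf
    simp only [hcosh, ← sum_div, sum_add_distrib]
    rw [← hswap]; ring
  have hbound : ∑ x ∈ X, ∑ y ∈ X, cosh (l * (g x - g y)) ≤ X.card * (X.card * exp (2 * l ^ 2)) := by
    have : ∀ x ∈ X, ∀ y ∈ X, cosh (l * (g x - g y)) ≤ exp (2 * l ^ 2) := by
      intro x hx y hy
      refine (cosh_le_exp_half_sq _).trans (exp_le_exp.2 ?_)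
      obtain ⟨hx0, hx2⟩ := hg x hx
      obtain ⟨hy0, hy2⟩ := hg y hy
      have : (g x - g y) ^ 2 ≤ 4 := by nlinarith
      rw [mul_pow]
      nlinarith [sq_nonneg l]
    calc _ ≤ ∑ x ∈ X, ∑ y ∈ X, exp (2 * l ^ 2) :=
          sum_le_sum fun x hx => sum_le_sum fun y hy => this x hx y hy
      _ = _ := by simp
  have hkey : ((1 / (X.card : ℝ)) * ∑ x ∈ X, exp (l * g x)) * exp (-(l * m)) ≤ exp (2 * l ^ 2) :=
    calc _ ≤ ((1 / (X.card : ℝ)) * ∑ x ∈ X, exp (l * g x)) *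
          ((1 / (X.card : ℝ)) * ∑ y ∈ X, exp (-(l * g y))) := by gcongr
      _ = (1 / (X.card : ℝ)) * ((1 / (X.card : ℝ)) *
          ∑ x ∈ X, ∑ y ∈ X, exp (l * g x) * exp (-(l * g y))) := by
          rw [← sum_mul_sum]; ring
      _ ≤ (1 / (X.card : ℝ)) * ((1 / (X.card : ℝ)) * (X.card * (X.card * exp (2 * l ^ 2)))) := by
          rw [hdouble]; gcongr
      _ = exp (2 * l ^ 2) := by field_simp
  rw [exp_add, mul_comm (exp (l * m))]
  rw [exp_neg, ← div_eq_mul_inv, div_le_iff₀ (exp_pos _)] at hkey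
  exact hkey

open Real Finset in
/-- The upper tail in Hoeffding's inequality for sampling without replacement. -/
theorem card_filter_sum_gt_le {α : Type*} (X : Finset α) (hX : X.Nonempty) (g : α → ℝ)
    (hg : ∀ x ∈ X, g x ∈ Set.Icc (0 : ℝ) 2) (s : ℕ) {t : ℝ} (ht : 0 ≤ t) :
    ((#{S ∈ X.powersetCard s | s * ((1 / (X.card : ℝ)) * ∑ x ∈ X, g x + t) < ∑ x ∈ S, g x} : ℕ) : ℝ)
      ≤ (X.powersetCard s).card * exp (-(s * t ^ 2 / 8)) := by
  set m := (1 / (X.card : ℝ)) * ∑ x ∈ X, g x with hm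
  set B := {S ∈ X.powersetCard s | s * (m + t) < ∑ x ∈ S, g x}
  -- Chernoff's method, with the exponent `t / 4`.
  have hmarkov : (B.card : ℝ) * exp (t / 4 * (s * (m + t))) ≤
      (X.powersetCard s).card * exp (t / 4 * m + 2 * (t / 4) ^ 2) ^ s :=
    calc _ = ∑ S ∈ B, exp (t / 4 * (s * (m + t))) := by simp
      _ ≤ ∑ S ∈ B, ∏ x ∈ S, exp (t / 4 * g x) := by
          refine sum_le_sum fun S hS => ?_
          rw [← exp_sum, ← mul_sum]
          have := (mem_filter.1 hS).2.le
          gcongr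
      _ ≤ ∑ S ∈ X.powersetCard s, ∏ x ∈ S, exp (t / 4 * g x) :=
          sum_le_sum_of_subset_of_nonneg (filter_subset _ _)
            fun S _ _ => prod_nonneg fun x _ => (exp_pos _).le
      _ ≤ _ := (sum_prod_powersetCard_le X _ (fun x _ => (exp_pos _).le) s).trans (by
          gcongr
          exact mean_exp_le X hX g hg _)
  rw [← le_div_iff₀ (exp_pos _), mul_div_assoc, ← exp_nat_mul, ← exp_sub] at hmarkov
  refine hmarkov.trans (le_of_eq ?_)
  congr 2
  ring

open Real Finset in
/-- Hoeffding's inequality for sampling without replacement: all but a fraction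
`2 exp (-s t² / 8)` of the `s`-subsets have a sample mean within `t` of the mean. -/
theorem card_filter_abs_sub_gt_le {α : Type*} (X : Finset α) (hX : X.Nonempty) (g : α → ℝ)
    (hg : ∀ x ∈ X, g x ∈ Set.Icc (0 : ℝ) 2) (s : ℕ) (hs : 0 < s) {t : ℝ} (ht : 0 ≤ t) :
    ((#{S ∈ X.powersetCard s |
        t < |(1 / (s : ℝ)) * ∑ x ∈ S, g x - (1 / (X.card : ℝ)) * ∑ x ∈ X, g x|} : ℕ) : ℝ)
      ≤ 2 * (X.powersetCard s).card * exp (-(s * t ^ 2 / 8)) := by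
  classical
  have hs' : (0 : ℝ) < s := by exact_mod_cast hs
  have hn : (0 : ℝ) < X.card := by exact_mod_cast hX.card_pos
  have h1 := card_filter_sum_gt_le X hX g hg s ht
  -- The lower tail of `g` is the upper tail of `2 - g`.
  have h2 := card_filter_sum_gt_le X hX (fun x => 2 - g x)
    (fun x hx => ⟨by linarith [(hg x hx).2], by linarith [(hg x hx).1]⟩) s ht
  set m := (1 / (X.card : ℝ)) * ∑ x ∈ X, g x with hm
  have hm2 : (1 / (X.card : ℝ)) * ∑ x ∈ X, (2 - g x) = 2 - m := by
    rw [hm, sum_sub_distrib, sum_const, nsmul_eq_mul]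
    field_simp
  rw [hm2] at h2
  have hsub : {S ∈ X.powersetCard s | t < |(1 / (s : ℝ)) * ∑ x ∈ S, g x - m|} ⊆
      {S ∈ X.powersetCard s | s * (m + t) < ∑ x ∈ S, g x} ∪
      {S ∈ X.powersetCard s | s * (2 - m + t) < ∑ x ∈ S, (2 - g x)} := by
    intro S hS
    rw [mem_filter] at hS
    obtain ⟨hSX, hS⟩ := hS
    rw [mem_union, mem_filter, mem_filter, sum_sub_distrib, sum_const, nsmul_eq_mul,
      (mem_powersetCard.1 hSX).2]
    have hsum : ∑ x ∈ S, g x = s * ((1 / (s : ℝ)) * ∑ x ∈ S, g x) := by field_simp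
    rw [hsum]
    rcases lt_abs.1 hS with h | h
    · left
      exact ⟨hSX, by gcongr; linarith⟩
    · right
      refine ⟨hSX, ?_⟩
      nlinarith
  have hcard : (#{S ∈ X.powersetCard s | t < |(1 / (s : ℝ)) * ∑ x ∈ S, g x - m|} : ℝ) ≤ _ :=
    Nat.cast_le.2 ((card_le_card hsub).trans (card_union_le _ _))
  push_cast at hcard
  linarith

namespace SRLK

/-! ### The clustering difference -/

section Diff
variable {α : Type*} {k : ℕ}

open Classical in
theorem clusteringDiff_le_perm (X : Finset α) (C C' : Fin k → Finset α) (σ : Equiv.Perm (Fin k)) :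
    clusteringDiff X C C' ≤ (1 / (X.card : ℝ)) * ∑ i, (((C i) ∆ (C' (σ i))).card : ℝ) :=
  ciInf_le (Set.finite_range _).bddBelow σ

open Classical in
theorem exists_perm_clusteringDiff_eq (X : Finset α) (C C' : Fin k → Finset α) :
    ∃ σ : Equiv.Perm (Fin k),
      clusteringDiff X C C' = (1 / (X.card : ℝ)) * ∑ i, (((C i) ∆ (C' (σ i))).card : ℝ) := by
  obtain ⟨σ, hσ⟩ := exists_eq_ciInf_of_finite
    (f := fun σ : Equiv.Perm (Fin k) => (1 / (X.card : ℝ)) * ∑ i, (((C i) ∆ (C' (σ i))).card : ℝ))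
  exact ⟨σ, hσ.symm⟩

theorem clusteringDiff_triangle (X : Finset α) (C C' C'' : Fin k → Finset α) :
    clusteringDiff X C C'' ≤ clusteringDiff X C C' + clusteringDiff X C' C'' := by
  classical
  obtain ⟨σ, hσ⟩ := exists_perm_clusteringDiff_eq X C C'
  obtain ⟨τ, hτ⟩ := exists_perm_clusteringDiff_eq X C' C''
  refine (clusteringDiff_le_perm X C C'' (σ.trans τ)).trans ?_
  rw [hσ, hτ, ← mul_add, ← Equiv.sum_comp σ fun i => (((C' i) ∆ (C'' (τ i))).card : ℝ),
    ← Finset.sum_add_distrib]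
  refine mul_le_mul_of_nonneg_left (Finset.sum_le_sum fun i _ => ?_) (by positivity)
  exact_mod_cast (Finset.card_le_card (symmDiff_triangle (C i) (C' (σ i)) (C'' (τ (σ i))))).trans
    (Finset.card_union_le _ _)

theorem clusteringDiff_le_of_perm (X : Finset α) (C C' C'' : Fin k → Finset α)
    (σ : Equiv.Perm (Fin k)) (h : ∀ i, C'' i = C' (σ i)) :
    clusteringDiff X C C' ≤ clusteringDiff X C C'' := by
  classical
  obtain ⟨τ, hτ⟩ := exists_perm_clusteringDiff_eq X C C''
  refine (clusteringDiff_le_perm X C C' (τ.trans σ)).trans (le_of_eq ?_)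
  rw [hτ]
  simp [h]

theorem IsClustering.of_perm {X : Finset α} {C C' : Fin k → Finset α} (hC : IsClustering X C)
    (σ : Equiv.Perm (Fin k)) (h : ∀ i, C' i = C (σ i)) : IsClustering X C' := by
  refine ⟨fun i j hij => ?_, fun x => ?_⟩
  · rw [h, h]
    exact hC.1 _ _ fun e => hij (σ.injective e)
  · rw [hC.2]
    refine ⟨fun ⟨i, hi⟩ => ⟨σ.symm i, by simpa [h] using hi⟩, fun ⟨i, hi⟩ => ⟨σ i, by rwa [← h]⟩⟩

theorem IsClustering.sum_eq {X : Finset α} {C : Fin k → Finset α} (hC : IsClustering X C)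
    (φ : α → ℝ) : ∑ x ∈ X, φ x = ∑ i, ∑ x ∈ C i, φ x := by
  classical
  have hX : X = Finset.univ.biUnion C := by
    ext x
    simp [hC.2 x]
  rw [hX, Finset.sum_biUnion fun i _ j _ hij => hC.1 i j hij]

end Diff

/-! ### The k-means objective -/

section KMeans
variable {α : Type*} {k d : ℕ}

/-- The closed unit cube `[0,1]^d`. -/
def cube (d : ℕ) : Set (Euc d) := {y | ∀ j, y j ∈ Set.Icc (0 : ℝ) 1}

/-- The nearest point of the unit cube. -/
noncomputable def clamp (y : Euc d) : Euc d := WithLp.toLp 2 fun j => max 0 (min 1 (y j))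

theorem clamp_mem_cube (y : Euc d) : clamp y ∈ cube d := fun j => by simp [clamp]

theorem norm_sub_clamp_sq_le {z : Euc d} (hz : z ∈ cube d) (y : Euc d) :
    ‖z - clamp y‖ ^ 2 ≤ ‖z - y‖ ^ 2 := by
  rw [EuclideanSpace.real_norm_sq_eq, EuclideanSpace.real_norm_sq_eq]
  refine Finset.sum_le_sum fun j _ => sq_le_sq.2 ?_
  obtain ⟨h0, h1⟩ := hz j
  simp only [clamp, PiLp.sub_apply]
  rcases le_total (y j) 1 with h | h <;> rcases le_total 0 (y j) with h' | h' <;>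
    simp only [abs_le, le_abs, h, h', min_eq_right, min_eq_left, max_eq_right, max_eq_left,
      zero_le_one] <;> grind

theorem iInf_norm_sq_le (y : Euc d) (μ : Fin k → Euc d) (i : Fin k) :
    ⨅ j, ‖y - μ j‖ ^ 2 ≤ ‖y - μ i‖ ^ 2 :=
  ciInf_le (Set.finite_range _).bddBelow i

theorem centerCost_clamp_le [Nonempty (Fin k)] {X : Finset α} {f : α → Euc d}
    (hf : ∀ x ∈ X, f x ∈ cube d) (μ : Fin k → Euc d) :
    centerCost X f (fun i => clamp (μ i)) ≤ centerCost X f μ := by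
  refine mul_le_mul_of_nonneg_left (Finset.sum_le_sum fun x hx => ?_) (by positivity)
  exact le_ciInf fun i => (iInf_norm_sq_le _ _ i).trans (norm_sub_clamp_sq_le (hf x hx) _)

theorem exists_isOptimalCenters_mem_cube [Nonempty (Fin k)] {X : Finset α} {f : α → Euc d}
    (hf : ∀ x ∈ X, f x ∈ cube d) :
    ∃ μ : Fin k → Euc d, IsOptimalCenters X f μ ∧ ∀ i, μ i ∈ cube d := by
  let Ψ : (Fin k → Fin d → ℝ) → Fin k → Euc d := fun ν i => WithLp.toLp 2 (ν i)
  have hcont : Continuous fun ν => centerCost X f (Ψ ν) := by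
    unfold centerCost
    refine continuous_const.mul (continuous_finsetSum _ fun x _ => ?_)
    simp only [← Finset.inf'_univ_eq_ciInf]
    refine Continuous.finset_inf'_apply _ fun i _ => ?_
    simp only [Ψ]
    fun_prop
  obtain ⟨ν, hν, hmin⟩ := (isCompact_Icc (a := (0 : Fin k → Fin d → ℝ)) (b := 1)).exists_isMinOn
    ⟨0, by simp⟩ hcont.continuousOn
  refine ⟨Ψ ν, fun μ => ?_, fun i j => ⟨hν.1 i j, hν.2 i j⟩⟩
  have hmem : (fun i j => clamp (μ i) j) ∈ Set.Icc (0 : Fin k → Fin d → ℝ) 1 :=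
    ⟨fun i j => (clamp_mem_cube (μ i) j).1, fun i j => (clamp_mem_cube (μ i) j).2⟩
  exact (hmin hmem).trans (centerCost_clamp_le hf μ)

theorem iInf_eq_of_mem_voronoi [Nonempty (Fin k)] {X : Finset α} {f : α → Euc d}
    {μ : Fin k → Euc d} {i : Fin k} {x : α} (hx : x ∈ voronoi X f μ i) :
    ⨅ j, ‖f x - μ j‖ ^ 2 = ‖f x - μ i‖ ^ 2 := by
  refine le_antisymm (iInf_norm_sq_le _ _ i) (le_ciInf fun j => ?_)
  have := (Finset.mem_filter.1 hx).2 j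
  gcongr

theorem clusteringCost_le (X : Finset α) (f : α → Euc d) (P : Fin k → Finset α)
    (c : Fin k → Euc d) :
    clusteringCost X f P ≤ (1 / (X.card : ℝ)) * ∑ i, ∑ x ∈ P i, ‖f x - c i‖ ^ 2 := by
  refine mul_le_mul_of_nonneg_left (Finset.sum_le_sum fun i _ => ?_) (by positivity)
  exact ciInf_le (f := fun c => ∑ x ∈ P i, ‖f x - c‖ ^ 2)
    ⟨0, by rintro _ ⟨c, rfl⟩; positivity⟩ (c i)

theorem IsOptimalCenters.centerCost_le_clusteringCost {X : Finset α}
    {f : α → Euc d} {μ : Fin k → Euc d} (hμ : IsOptimalCenters X f μ) {P : Fin k → Finset α}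
    (hP : IsClustering X P) : centerCost X f μ ≤ clusteringCost X f P := by
  unfold clusteringCost
  rw [← sub_nonpos]
  refine le_of_forall_pos_le_add fun e he => ?_
  let e' : ℝ := e / ((1 / (X.card : ℝ)) * k + 1)
  have he' : 0 < e' := by positivity
  have hc : ∀ i, ∃ c : Euc d, ∑ x ∈ P i, ‖f x - c‖ ^ 2 <
      (⨅ c : Euc d, ∑ x ∈ P i, ‖f x - c‖ ^ 2) + e' := fun i =>
    exists_lt_of_ciInf_lt (lt_add_of_pos_right _ he')
  choose c hc using hc
  have h1 : centerCost X f c ≤ (1 / (X.card : ℝ)) * ∑ i, ∑ x ∈ P i, ‖f x - c i‖ ^ 2 := by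
    unfold centerCost
    rw [hP.sum_eq]
    gcongr with i _ x hx
    exact iInf_norm_sq_le _ _ i
  have h2 : (1 / (X.card : ℝ)) * ∑ i, ∑ x ∈ P i, ‖f x - c i‖ ^ 2 ≤
      (1 / (X.card : ℝ)) * ∑ i, ((⨅ c : Euc d, ∑ x ∈ P i, ‖f x - c‖ ^ 2) + e') := by
    gcongr with i _
    exact (hc i).le
  rw [Finset.sum_add_distrib, mul_add] at h2
  have h3 : (1 / (X.card : ℝ)) * ∑ _i : Fin k, e' ≤ e := by
    simp only [Finset.sum_const, Finset.card_univ, Fintype.card_fin, nsmul_eq_mul, e']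
    rw [← mul_assoc, mul_div_assoc', div_le_iff₀ (by positivity)]
    nlinarith
  linarith [hμ c]

/-- A mapping with a unique k-means solution has optimal centers in the unit cube whose Voronoi
cells form the k-means clustering, up to numbering. The centers chosen by `optimalCenters` may lie
outside the cube, when some cells are empty. -/
theorem IsUnique.exists_centers [Nonempty (Fin k)] {X : Finset α} {f : α → Euc d} {η ε : ℝ}
    (hu : IsUnique k X f η ε) (hf : ∀ x ∈ X, f x ∈ cube d) :
    ∃ μ : Fin k → Euc d, IsOptimalCenters X f μ ∧ (∀ i, μ i ∈ cube d) ∧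
      ∃ σ : Equiv.Perm (Fin k), ∀ i, voronoi X f μ i = kmeans k X f (σ i) := by
  obtain ⟨μ, hμ, hcube⟩ := exists_isOptimalCenters_mem_cube (k := k) hf
  exact ⟨μ, hμ, hcube, hu.2.1 μ hμ⟩

/-- If some renumbering `P'` of the partition `P`, served by suitable centers, is nearly optimal
for `f`, then `P` is close to the k-means clustering under `f`. -/
theorem IsUnique.clusteringDiff_lt {X : Finset α} {f : α → Euc d} {η ε : ℝ}
    (hu : IsUnique k X f η ε) {μ : Fin k → Euc d} (hμ : IsOptimalCenters X f μ)
    {P P' : Fin k → Finset α} (hP : IsClustering X P) (σ : Equiv.Perm (Fin k))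
    (hσ : ∀ i, P' i = P (σ i)) (c : Fin k → Euc d)
    (hc : (1 / (X.card : ℝ)) * ∑ i, ∑ x ∈ P' i, ‖f x - c i‖ ^ 2 < centerCost X f μ + η) :
    clusteringDiff X (kmeans k X f) P < ε := by
  have hP' := hP.of_perm σ hσ
  refine (clusteringDiff_le_of_perm X _ P P' σ hσ).trans_lt (hu.2.2 P' hP' ?_)
  have := hμ.centerCost_le_clusteringCost hu.1
  linarith [clusteringCost_le X f P' c]

theorem abs_norm_sub_sq_sub_le {y z c : Euc d} (hy : y ∈ cube d) (hz : z ∈ cube d)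
    (hc : c ∈ cube d) {a : ℝ} (h : ∀ j, |y j - z j| ≤ a) :
    |‖y - c‖ ^ 2 - ‖z - c‖ ^ 2| ≤ d * (2 * a) := by
  rw [EuclideanSpace.real_norm_sq_eq, EuclideanSpace.real_norm_sq_eq, ← Finset.sum_sub_distrib]
  refine (Finset.abs_sum_le_sum_abs _ _).trans ?_
  refine (Finset.sum_le_card_nsmul _ _ (2 * a) fun j _ => ?_).trans (by simp)
  obtain ⟨hy0, hy1⟩ := hy j
  obtain ⟨hz0, hz1⟩ := hz j
  obtain ⟨hc0, hc1⟩ := hc j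
  have hfac : (y - c) j ^ 2 - (z - c) j ^ 2 = (y j + z j - 2 * c j) * (y j - z j) := by
    simp only [PiLp.sub_apply]; ring
  rw [hfac, abs_mul]
  have h2 : |y j + z j - 2 * c j| ≤ 2 := abs_le.2 ⟨by linarith, by linarith⟩
  exact mul_le_mul h2 (h j) (abs_nonneg _) (by norm_num)

theorem mean_add_const {X : Finset α} (hX : X.Nonempty) (φ : α → ℝ) (b : ℝ) :
    (1 / (X.card : ℝ)) * ∑ x ∈ X, (φ x + b) = (1 / (X.card : ℝ)) * ∑ x ∈ X, φ x + b := by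
  have hn : (X.card : ℝ) ≠ 0 := by exact_mod_cast hX.card_pos.ne'
  rw [Finset.sum_add_distrib, Finset.sum_const, nsmul_eq_mul]
  field_simp

/-- Mappings that are close in every coordinate have close k-means clusterings. -/
theorem clusteringDiff_kmeans_lt_of_close [Nonempty (Fin k)] {X : Finset α} (hX : X.Nonempty)
    {f g : α → Euc d} {η ε a : ℝ} (hf : ∀ x ∈ X, f x ∈ cube d) (hg : ∀ x ∈ X, g x ∈ cube d)
    (huf : IsUnique k X f η ε) (hug : IsUnique k X g η ε)
    (hclose : ∀ x ∈ X, ∀ j, |f x j - g x j| ≤ a) (ha : 4 * d * a < η) :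
    clusteringDiff X (kmeans k X f) (kmeans k X g) < ε := by
  obtain ⟨μ, hμ, hμc, -⟩ := huf.exists_centers hf
  obtain ⟨ν, hν, hνc, σ, hσ⟩ := hug.exists_centers hg
  refine huf.clusteringDiff_lt hμ hug.1 σ hσ ν ?_
  have h1 : (1 / (X.card : ℝ)) * ∑ i, ∑ x ∈ voronoi X g ν i, ‖f x - ν i‖ ^ 2 ≤
      centerCost X g ν + d * (2 * a) := by
    unfold centerCost
    rw [← mean_add_const hX, (hug.1.of_perm σ hσ).sum_eq]
    gcongr with i _ x hx
    rw [iInf_eq_of_mem_voronoi hx]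
    have hxX := (Finset.mem_filter.1 hx).1
    linarith [(abs_le.1 (abs_norm_sub_sq_sub_le (hf x hxX) (hg x hxX) (hνc i) (hclose x hxX))).2]
  have h2 : centerCost X g μ ≤ centerCost X f μ + d * (2 * a) := by
    unfold centerCost
    rw [← mean_add_const hX]
    gcongr with x hx
    rw [← sub_le_iff_le_add]
    refine le_ciInf fun i => ?_
    have := iInf_norm_sq_le (g x) μ i
    linarith [(abs_le.1 (abs_norm_sub_sq_sub_le (hf x hx) (hg x hx) (hμc i) (hclose x hx))).1]
  linarith [hν μ]

/-- The affine function of `y` with `‖y - c‖² = ‖y‖² + power y c`: comparing centers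
amounts to comparing these functions. -/
noncomputable def power (y c : Euc d) : ℝ := ‖c‖ ^ 2 - 2 * inner ℝ y c

theorem norm_sub_sq_eq_power (y c : Euc d) : ‖y - c‖ ^ 2 = ‖y‖ ^ 2 + power y c := by
  rw [norm_sub_sq_real, power]; ring

theorem abs_power_le {y c : Euc d} (hy : y ∈ cube d) (hc : c ∈ cube d) : |power y c| ≤ d := by
  have h : power y c = ‖y - c‖ ^ 2 - ‖y‖ ^ 2 := by rw [norm_sub_sq_eq_power]; ring
  rw [h, EuclideanSpace.real_norm_sq_eq, EuclideanSpace.real_norm_sq_eq,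
    ← Finset.sum_sub_distrib]
  refine (Finset.abs_sum_le_sum_abs _ _).trans ?_
  refine (Finset.sum_le_card_nsmul _ _ (1 : ℝ) fun j _ => ?_).trans (by simp)
  obtain ⟨hy0, hy1⟩ := hy j
  obtain ⟨hc0, hc1⟩ := hc j
  simp only [PiLp.sub_apply]
  exact abs_le.2 ⟨by nlinarith, by nlinarith⟩

/-- Mappings with optimal centers for which the functions that define the Voronoi
cells are close have close k-means clusterings, however far apart the mappings themselves are. -/
theorem clusteringDiff_kmeans_lt_of_power_close [Nonempty (Fin k)] {X : Finset α}
    (hX : X.Nonempty) {f g : α → Euc d} {η ε a : ℝ}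
    (huf : IsUnique k X f η ε) (hug : IsUnique k X g η ε) {μ ν : Fin k → Euc d}
    (hμ : IsOptimalCenters X f μ) (hν : IsOptimalCenters X g ν)
    (hclose : ∀ x ∈ X, ∀ i, |power (f x) (μ i) - power (g x) (ν i)| ≤ a) (ha : 2 * a < η) :
    clusteringDiff X (kmeans k X f) (kmeans k X g) < ε := by
  obtain ⟨σ, hσ⟩ := hug.2.1 ν hν
  refine huf.clusteringDiff_lt hμ hug.1 σ hσ μ ?_
  have h1 : (1 / (X.card : ℝ)) * ∑ i, ∑ x ∈ voronoi X g ν i, ‖f x - μ i‖ ^ 2 ≤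
      centerCost X f μ + 2 * a := by
    unfold centerCost
    rw [← mean_add_const hX, (hug.1.of_perm σ hσ).sum_eq]
    gcongr with i _ x hx
    obtain ⟨hxX, hxi⟩ := Finset.mem_filter.1 hx
    rw [← sub_le_iff_le_add]
    refine le_ciInf fun j => ?_
    have hij : ‖g x - ν i‖ ^ 2 ≤ ‖g x - ν j‖ ^ 2 := by have := hxi j; gcongr
    simp only [norm_sub_sq_eq_power] at hij ⊢
    linarith [(abs_le.1 (hclose x hxX i)).2, (abs_le.1 (hclose x hxX j)).1]
  linarith

end KMeans

/-! ### Finite nets of k-means clusterings -/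

theorem log_card_le {n D : ℕ} {b : ℝ} (hb : 1 ≤ b) (h : (n : ℝ) ≤ b ^ D) :
    Real.log n ≤ D * Real.log b := by
  rcases Nat.eq_zero_or_pos n with rfl | hn
  · simpa using mul_nonneg (Nat.cast_nonneg D) (Real.log_nonneg hb)
  · rw [← Real.log_pow]
    exact Real.log_le_log (by exact_mod_cast hn) h

theorem one_le_log_of_three_le {u : ℝ} (hu : 3 ≤ u) : 1 ≤ Real.log u := by
  rw [Real.le_log_iff_exp_le (by linarith)]
  linarith [Real.exp_one_lt_d9]

variable {k d₁ d₂ : ℕ}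

/-- The values of a linear map at the points of `X`. -/
def evalMap (X : Finset (Euc d₁)) : (Euc d₁ →ₗ[ℝ] Euc d₂) →ₗ[ℝ] (X × Fin d₂ → ℝ) where
  toFun f p := f p.1 p.2
  map_add' _ _ := rfl
  map_smul' _ _ := rfl

/-- The values of a `k`-tuple of affine functions at the points of `X`. -/
def evalAffine (X : Finset (Euc d₁)) :
    (Fin k → ℝ × (Euc d₁ →ₗ[ℝ] ℝ)) →ₗ[ℝ] (X × Fin k → ℝ) where
  toFun h p := (h p.2).1 + (h p.2).2 p.1
  map_add' h h' := by ext p; simp; ring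
  map_smul' r h := by ext p; simp; ring

/-- A net of the mappings themselves; its size is governed by the `d₁ d₂` entries of a matrix. -/
theorem exists_net_of_coordinates (hk : 1 ≤ k) {F : Set (Euc d₁ →ₗ[ℝ] Euc d₂)} {η ε : ℝ}
    (hη : 0 < η) {X : Finset (Euc d₁)} (hX : X ∈ domains k F η ε) :
    ∃ T : Finset F, Real.log T.card ≤ (d₁ * d₂ : ℕ) * Real.log (1 + 8 * (d₂ + 1) / η) ∧
      ∀ f : F, ∃ t ∈ T, clusteringDiff X (kmeans k X f.1) (kmeans k X t.1) < ε := by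
  have : Nonempty (Fin k) := ⟨⟨0, hk⟩⟩
  obtain ⟨hne, hF⟩ := hX
  have hcube : ∀ f : F, ∀ x ∈ X, f.1 x ∈ cube d₂ := fun f x hx j =>
    Set.Ioo_subset_Icc_self ((hF f.1 f.2).1 x hx j)
  have hdim : Module.finrank ℝ (LinearMap.range (evalMap (d₂ := d₂) X)) ≤ d₁ * d₂ :=
    (LinearMap.finrank_range_le _).trans (by simp [Module.finrank_linearMap])
  have hα : 0 < η / (4 * (d₂ + 1)) := by positivity
  obtain ⟨T, hcard, hT⟩ := exists_sup_net _ hdim (fun f : F => evalMap X f.1)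
    (fun f => LinearMap.mem_range_self _ _) zero_le_one hα (fun f p => by
      have := hcube f p.1 p.1.2 p.2
      exact abs_le.2 ⟨by linarith [this.1, show evalMap X f.1 p = f.1 p.1 p.2 from rfl], this.2⟩)
  refine ⟨T, ?_, fun f => ?_⟩
  · refine log_card_le (le_add_of_nonneg_right (by positivity)) (hcard.trans_eq ?_)
    congr 2
    field_simp
    ring
  · obtain ⟨t, ht, hclose⟩ := hT f
    refine ⟨t, ht, clusteringDiff_kmeans_lt_of_close hne (hcube f) (hcube t) (hF f.1 f.2).2
      (hF t.1 t.2).2 (fun x hx j => hclose (⟨x, hx⟩, j)) ?_⟩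
    rw [mul_div_assoc', div_lt_iff₀ (by positivity)]
    nlinarith

/-- A net of the `k` affine functions whose comparison defines the Voronoi cells; its size is
governed by their `k (d₁ + 1)` coefficients. -/
theorem exists_net_of_power (hk : 1 ≤ k) {F : Set (Euc d₁ →ₗ[ℝ] Euc d₂)} {η ε : ℝ}
    (hη : 0 < η) {X : Finset (Euc d₁)} (hX : X ∈ domains k F η ε) :
    ∃ T : Finset F, Real.log T.card ≤ (k * (d₁ + 1) : ℕ) * Real.log (1 + 8 * d₂ / η) ∧
      ∀ f : F, ∃ t ∈ T, clusteringDiff X (kmeans k X f.1) (kmeans k X t.1) < ε := by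
  have : Nonempty (Fin k) := ⟨⟨0, hk⟩⟩
  obtain ⟨hne, hF⟩ := hX
  have hcube : ∀ f : F, ∀ x ∈ X, f.1 x ∈ cube d₂ := fun f x hx j =>
    Set.Ioo_subset_Icc_self ((hF f.1 f.2).1 x hx j)
  choose μ hμ hμc _ using fun f : F => (hF f.1 f.2).2.exists_centers (hcube f)
  have hdim : Module.finrank ℝ (LinearMap.range (evalAffine (k := k) X)) ≤ k * (d₁ + 1) :=
    (LinearMap.finrank_range_le (evalAffine (k := k) X)).trans
      (by simp [Module.finrank_pi_fintype, add_comm])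
  have hα : 0 < η / 4 := by positivity
  obtain ⟨T, hcard, hT⟩ := exists_sup_net _ hdim
    (fun (f : F) (p : X × Fin k) => power (f.1 p.1) (μ f p.2))
    (fun f => ⟨fun i => (‖μ f i‖ ^ 2, -(2 : ℝ) • ((innerₛₗ ℝ (μ f i)).comp f.1)), by
      funext p
      change ‖μ f p.2‖ ^ 2 + -(2 : ℝ) * inner ℝ (μ f p.2) (f.1 p.1) =
        ‖μ f p.2‖ ^ 2 - 2 * inner ℝ (f.1 p.1) (μ f p.2)
      rw [real_inner_comm]
      ring⟩) (Nat.cast_nonneg d₂) hα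
    (fun f p => abs_power_le (hcube f p.1 p.1.2) (hμc f p.2))
  refine ⟨T, ?_, fun f => ?_⟩
  · refine log_card_le (le_add_of_nonneg_right (by positivity)) (hcard.trans_eq ?_)
    congr 2
    field_simp
    ring
  · obtain ⟨t, ht, hclose⟩ := hT f
    exact ⟨t, ht, clusteringDiff_kmeans_lt_of_power_close hne (hF f.1 f.2).2
      (hF t.1 t.2).2 (hμ f) (hμ t) (fun x hx i => hclose (⟨x, hx⟩, i)) (by linarith)⟩

theorem log_coordinates_le {η : ℝ} (hη : 0 < η) (hk : 1 ≤ k) (h : d₂ ≤ k) :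
    Real.log (1 + 8 * (d₂ + 1) / η) ≤ 4 * Real.log (2 + k + 1 / η) := by
  have hηi : 0 < 1 / η := by positivity
  have hd : (d₂ : ℝ) ≤ k := by exact_mod_cast h
  have hk1 : (1 : ℝ) ≤ k := by exact_mod_cast hk
  set u : ℝ := 2 + k + 1 / η with hu
  have hprod : ((d₂ : ℝ) + 1) * (1 / η) ≤ (u - 1) * u := by
    gcongr <;> linarith
  have hu3 : 3 ≤ u := by linarith
  rw [show (4 : ℝ) * Real.log u = ((4 : ℕ) : ℝ) * Real.log u by norm_num, ← Real.log_pow]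
  apply Real.log_le_log (by positivity)
  have : 8 * ((d₂ : ℝ) + 1) / η = 8 * ((d₂ + 1) * (1 / η)) := by ring
  rw [this]
  nlinarith [mul_le_mul_of_nonneg_left (show 9 ≤ u ^ 2 by nlinarith) (sq_nonneg u)]

/-- The logarithm of `d₂` in the size of the net of affine functions is absorbed by `d₂ / k`. -/
theorem log_power_le {η : ℝ} (hη : 0 < η) (hk : 1 ≤ k) (h : k ≤ d₂) :
    k * Real.log (1 + 8 * d₂ / η) ≤ 7 * d₂ * Real.log (2 + k + 1 / η) := by
  have hηi : 0 < 1 / η := by positivity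
  have hkd : (k : ℝ) ≤ d₂ := by exact_mod_cast h
  have hk1 : (1 : ℝ) ≤ k := by exact_mod_cast hk
  set u : ℝ := 2 + k + 1 / η with hu
  have hu3 : 3 ≤ u := by linarith
  have hlog := one_le_log_of_three_le hu3
  have h1 : Real.log (1 + 8 * d₂ / η) ≤ Real.log (u ^ 2 * (2 + d₂) * u) := by
    apply Real.log_le_log (by positivity)
    have e : 8 * (d₂ : ℝ) / η = 8 * d₂ * (1 / η) := by ring
    have : 8 * (d₂ : ℝ) * (1 / η) ≤ 8 * d₂ * u := by gcongr; linarith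
    have h9 : 9 * ((2 + d₂) * u) ≤ u ^ 2 * ((2 + d₂) * u) := by gcongr; nlinarith
    rw [e]
    nlinarith
  rw [Real.log_mul (by positivity) (by positivity), Real.log_mul (by positivity) (by positivity),
    Real.log_pow] at h1
  have h2 : Real.log (2 + d₂) ≤ Real.log u + (2 + d₂) / (2 + k) := by
    have hr : (2 + d₂ : ℝ) = (2 + k) * ((2 + d₂) / (2 + k)) := by field_simp
    have hlk : Real.log (2 + k) ≤ Real.log u := Real.log_le_log (by positivity) (by linarith)
    conv_lhs => rw [hr]
    rw [Real.log_mul (by positivity) (by positivity)]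
    linarith [Real.log_le_sub_one_of_pos (show 0 < (2 + d₂ : ℝ) / (2 + k) by positivity)]
  have h3 : (k : ℝ) * ((2 + d₂) / (2 + k)) ≤ 3 * d₂ := by
    rw [mul_div_assoc', div_le_iff₀ (by positivity)]
    nlinarith
  push_cast at h1
  have h4 : (k : ℝ) * Real.log (1 + 8 * d₂ / η) ≤
      k * (4 * Real.log u + (2 + d₂) / (2 + k)) := by gcongr; linarith
  nlinarith

/-- The k-means clusterings of the members of `F` have a finite net. For `d₂ ≤ k` it is a net of
mappings, and so it is in the trivial case `d₁ = 0`. For `d₂ > k` the bound for that net would be too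
large by a factor `log d₂`, and a net of the functions that define the Voronoi cells is used. -/
theorem exists_net_kmeans (hk : 1 ≤ k) {F : Set (Euc d₁ →ₗ[ℝ] Euc d₂)} {η ε : ℝ}
    (hη : 0 < η) {X : Finset (Euc d₁)} (hX : X ∈ domains k F η ε) :
    ∃ T : Finset F, Real.log T.card ≤ 14 * ((k + d₁ * d₂) * Real.log (2 + k + 1 / η)) ∧
      ∀ f : F, ∃ t ∈ T, clusteringDiff X (kmeans k X f.1) (kmeans k X t.1) < ε := by
  have hηi : 0 < 1 / η := by positivity
  have hk1 : (1 : ℝ) ≤ k := by exact_mod_cast hk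
  have hlog : 1 ≤ Real.log (2 + k + 1 / η) := one_le_log_of_three_le (by linarith)
  have hkL : 0 ≤ (k : ℝ) * Real.log (2 + k + 1 / η) := by positivity
  have hdL : 0 ≤ (d₁ : ℝ) * d₂ * Real.log (2 + k + 1 / η) := by positivity
  by_cases hcase : d₁ = 0 ∨ d₂ ≤ k
  · obtain ⟨T, hcard, hT⟩ := exists_net_of_coordinates hk hη hX
    refine ⟨T, hcard.trans ?_, hT⟩
    rcases hcase with rfl | h
    · rw [zero_mul, Nat.cast_zero, zero_mul]
      linarith
    · have := mul_le_mul_of_nonneg_left (log_coordinates_le hη hk h)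
        (Nat.cast_nonneg (α := ℝ) (d₁ * d₂))
      push_cast at this ⊢
      linarith
  · obtain ⟨hd, hkd⟩ := not_or.1 hcase
    obtain ⟨T, hcard, hT⟩ := exists_net_of_power hk hη hX
    refine ⟨T, hcard.trans ?_, hT⟩
    have hd1 : (1 : ℝ) ≤ d₁ := by exact_mod_cast Nat.one_le_iff_ne_zero.2 hd
    have h1 := log_power_le (d₂ := d₂) hη hk (by omega)
    have h2 : 0 ≤ (k : ℝ) * Real.log (1 + 8 * d₂ / η) :=
      mul_nonneg (by positivity) (Real.log_nonneg (le_add_of_nonneg_right (by positivity)))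
    have h3 := mul_le_mul_of_nonneg_left h1 (show (0 : ℝ) ≤ d₁ by positivity)
    push_cast
    nlinarith

/-! ### Uniform convergence of the clustering difference -/

section Sampling
variable {α : Type*} {k : ℕ}

open Classical in
/-- The number of parts on which the membership of `x` differs between `C` and the renumbering of
`C'` by `σ`. Its mean over `X` is the quantity minimized in `clusteringDiff`. -/
noncomputable def mismatch (C C' : Fin k → Finset α) (σ : Equiv.Perm (Fin k)) (x : α) : ℝ :=
  ((Finset.univ.filter fun i => x ∈ (C i) ∆ (C' (σ i))).card : ℝ)

theorem mismatch_mem_Icc {X : Finset α} {C C' : Fin k → Finset α} (hC : IsClustering X C)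
    (hC' : IsClustering X C') (σ : Equiv.Perm (Fin k)) (x : α) :
    mismatch C C' σ x ∈ Set.Icc (0 : ℝ) 2 := by
  classical
  have huniq : ∀ {D : Fin k → Finset α}, IsClustering X D → ∀ {i j}, x ∈ D i → x ∈ D j → i = j := by
    intro D hD i j hi hj
    by_contra hij
    exact Finset.disjoint_left.1 (hD.1 i j hij) hi hj
  have hsub : (Finset.univ.filter fun i => x ∈ (C i) ∆ (C' (σ i))) ⊆
      (Finset.univ.filter fun i => x ∈ C i) ∪ Finset.univ.filter fun i => x ∈ C' (σ i) := by
    intro i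
    simp only [Finset.mem_filter, Finset.mem_union, Finset.mem_univ, true_and,
      Finset.mem_symmDiff]
    tauto
  have h1 : (Finset.univ.filter fun i => x ∈ C i).card ≤ 1 :=
    Finset.card_le_one.2 fun i hi j hj =>
      huniq hC (Finset.mem_filter.1 hi).2 (Finset.mem_filter.1 hj).2
  have h2 : (Finset.univ.filter fun i => x ∈ C' (σ i)).card ≤ 1 :=
    Finset.card_le_one.2 fun i hi j hj =>
      σ.injective (huniq hC' (Finset.mem_filter.1 hi).2 (Finset.mem_filter.1 hj).2)
  have h3 := (Finset.card_le_card hsub).trans (Finset.card_union_le _ _)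
  refine ⟨Nat.cast_nonneg _, ?_⟩
  unfold mismatch
  exact_mod_cast (show _ ≤ 2 by convert h3.trans (add_le_add h1 h2))

open Classical in
theorem sum_card_symmDiff_restrict (C C' : Fin k → Finset α) (σ : Equiv.Perm (Fin k))
    (S : Finset α) :
    ∑ i, (((restrict C S i) ∆ (restrict C' S (σ i))).card : ℝ) = ∑ x ∈ S, mismatch C C' σ x := by
  have h : ∀ i, (((restrict C S i) ∆ (restrict C' S (σ i))).card : ℝ) =
      ∑ x ∈ S, if x ∈ (C i) ∆ (C' (σ i)) then 1 else 0 := by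
    intro i
    rw [Finset.sum_boole]
    congr 2
    ext x
    simp only [restrict, Finset.mem_symmDiff, Finset.mem_inter, Finset.mem_filter]
    tauto
  simp only [h, mismatch]
  rw [Finset.sum_comm]
  simp

theorem clusteringDiff_restrict (C C' : Fin k → Finset α) (S : Finset α) :
    clusteringDiff S (restrict C S) (restrict C' S) =
      ⨅ σ : Equiv.Perm (Fin k), (1 / (S.card : ℝ)) * ∑ x ∈ S, mismatch C C' σ x := by
  unfold clusteringDiff
  simp only [← sum_card_symmDiff_restrict]

theorem IsClustering.restrict_self {X : Finset α} {C : Fin k → Finset α} (hC : IsClustering X C) :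
    restrict C X = C := by
  classical
  funext i
  exact Finset.inter_eq_left.2 fun x hx => (hC.2 x).2 ⟨i, hx⟩

theorem abs_iInf_sub_iInf_le {ι : Type*} [Finite ι] [Nonempty ι] {a b : ι → ℝ} {t : ℝ}
    (h : ∀ i, |a i - b i| ≤ t) : |(⨅ i, a i) - ⨅ i, b i| ≤ t := by
  obtain ⟨i, hi⟩ := exists_eq_ciInf_of_finite (f := a)
  obtain ⟨j, hj⟩ := exists_eq_ciInf_of_finite (f := b)
  have h1 := ciInf_le (Set.finite_range a).bddBelow j
  have h2 := ciInf_le (Set.finite_range b).bddBelow i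
  have hi' := abs_le.1 (h i)
  have hj' := abs_le.1 (h j)
  exact abs_le.2 ⟨by linarith, by linarith⟩

theorem abs_clusteringDiff_restrict_sub_le {X S : Finset α} {C C' : Fin k → Finset α}
    (hC : IsClustering X C) (hC' : IsClustering X C') {t : ℝ}
    (h : ∀ σ, |(1 / (S.card : ℝ)) * ∑ x ∈ S, mismatch C C' σ x -
      (1 / (X.card : ℝ)) * ∑ x ∈ X, mismatch C C' σ x| ≤ t) :
    |clusteringDiff S (restrict C S) (restrict C' S) - clusteringDiff X C C'| ≤ t := by
  have hX := clusteringDiff_restrict C C' X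
  rw [hC.restrict_self, hC'.restrict_self] at hX
  rw [hX, clusteringDiff_restrict]
  exact abs_iInf_sub_iInf_le h

open Classical in
/-- For a uniformly random `s`-subset `S`, the difference to `C` of all clusterings of a finite
family is estimated by its restriction to `S`. The union bound runs over the family
and over the renumberings. -/
theorem card_filter_deviation_le {ι : Type*} {X : Finset α} (hX : X.Nonempty)
    {C : Fin k → Finset α} (hC : IsClustering X C) (T : Finset ι) {D : ι → Fin k → Finset α}
    (hD : ∀ i ∈ T, IsClustering X (D i)) {s : ℕ} (hs : 0 < s) {t : ℝ} (ht : 0 ≤ t) :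
    (((X.powersetCard s).filter fun S => ∃ i ∈ T,
        t < |clusteringDiff S (restrict C S) (restrict (D i) S) - clusteringDiff X C (D i)|).card : ℝ)
      ≤ T.card * k.factorial * (2 * (X.powersetCard s).card * Real.exp (-(s * t ^ 2 / 8))) := by
  let B : ι → Equiv.Perm (Fin k) → Finset (Finset α) := fun i σ =>
    (X.powersetCard s).filter fun S => t < |(1 / (s : ℝ)) * ∑ x ∈ S, mismatch C (D i) σ x -
      (1 / (X.card : ℝ)) * ∑ x ∈ X, mismatch C (D i) σ x|
  have hsub : ((X.powersetCard s).filter fun S => ∃ i ∈ T,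
      t < |clusteringDiff S (restrict C S) (restrict (D i) S) - clusteringDiff X C (D i)|) ⊆
      T.biUnion fun i => Finset.univ.biUnion fun σ => B i σ := by
    intro S hS
    obtain ⟨hSX, i, hi, hdev⟩ := Finset.mem_filter.1 hS
    by_contra hcon
    refine hdev.not_ge (abs_clusteringDiff_restrict_sub_le hC (hD i hi) fun σ => ?_)
    by_contra! hσ
    refine hcon (Finset.mem_biUnion.2 ⟨i, hi, Finset.mem_biUnion.2 ⟨σ, Finset.mem_univ _, ?_⟩⟩)
    rw [(Finset.mem_powersetCard.1 hSX).2] at hσ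
    exact Finset.mem_filter.2 ⟨hSX, hσ⟩
  have hB : ∀ i ∈ T, ∀ σ, ((B i σ).card : ℝ) ≤
      2 * (X.powersetCard s).card * Real.exp (-(s * t ^ 2 / 8)) := fun i hi σ =>
    card_filter_abs_sub_gt_le X hX _ (fun x _ => mismatch_mem_Icc hC (hD i hi) σ x) s hs ht
  calc _ ≤ ((T.biUnion fun i => Finset.univ.biUnion fun σ => B i σ).card : ℝ) :=
        Nat.cast_le.2 (Finset.card_le_card hsub)
    _ ≤ ∑ i ∈ T, ∑ σ, ((B i σ).card : ℝ) := by
        exact_mod_cast Finset.card_biUnion_le.trans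
          (Finset.sum_le_sum fun i _ => Finset.card_biUnion_le)
    _ ≤ ∑ i ∈ T, ∑ _σ : Equiv.Perm (Fin k),
          2 * (X.powersetCard s).card * Real.exp (-(s * t ^ 2 / 8)) :=
        Finset.sum_le_sum fun i hi => Finset.sum_le_sum fun σ _ => hB i hi σ
    _ = _ := by
        simp only [Finset.sum_const, Finset.card_univ, Fintype.card_perm, Fintype.card_fin,
          nsmul_eq_mul]
        ring

end Sampling

/-! ### Sample complexity of empirical risk minimization over a net -/

theorem log_factorial_le (k : ℕ) : Real.log k.factorial ≤ k * Real.log (2 + k) := by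
  have h : (k.factorial : ℝ) ≤ (2 + k) ^ k := by
    calc (k.factorial : ℝ) ≤ (k : ℝ) ^ k := by exact_mod_cast Nat.factorial_le_pow k
      _ ≤ _ := by gcongr; linarith
  rw [← Real.log_pow]
  exact Real.log_le_log (by exact_mod_cast k.factorial_pos) h

/-- A mapping that minimizes the empirical difference over a net, up to twice the estimation error,
is as good as the best one in `F` up to the radius of the net. -/
theorem clusteringDiff_le_iInf_add {k d₁ d₂ : ℕ} {F : Set (Euc d₁ →ₗ[ℝ] Euc d₂)}
    (hF : F.Nonempty) {X S : Finset (Euc d₁)} {C : Fin k → Finset (Euc d₁)} {T : Finset F}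
    {ε t : ℝ}
    (hnet : ∀ f : F, ∃ g ∈ T, clusteringDiff X (kmeans k X f.1) (kmeans k X g.1) < ε)
    (hdev : ∀ g ∈ T, |clusteringDiff S (restrict C S) (restrict (kmeans k X g.1) S) -
      clusteringDiff X C (kmeans k X g.1)| ≤ t)
    {g₀ : F} (hg₀ : g₀ ∈ T) (hmin : ∀ g ∈ T,
      clusteringDiff S (restrict C S) (restrict (kmeans k X g₀.1) S) ≤
        clusteringDiff S (restrict C S) (restrict (kmeans k X g.1) S)) :
    clusteringDiff X C (kmeans k X g₀.1) ≤
      (⨅ f : F, clusteringDiff X C (kmeans k X f.1)) + (ε + 2 * t) := by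
  have := hF.to_subtype
  rw [← sub_le_iff_le_add]
  refine le_ciInf fun f => ?_
  obtain ⟨g, hg, hfg⟩ := hnet f
  have h0 := (abs_le.1 (hdev g₀ hg₀)).1
  have h1 := (abs_le.1 (hdev g hg)).2
  linarith [hmin g hg, clusteringDiff_triangle X C (kmeans k X f.1) (kmeans k X g.1)]

end SRLK

theorem corollary1 :
    ∃ K : ℝ, 0 < K ∧
      ∀ (k d₁ d₂ : ℕ), 1 ≤ k →
      ∀ F : Set (SRLK.Euc d₁ →ₗ[ℝ] SRLK.Euc d₂), F.Nonempty →
      ∀ η ε : ℝ, 0 < η → ε ∈ Set.Ioo (0 : ℝ) 1 →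
        ∃ A : SRLK.Learner k d₁ d₂,
          ∀ θ ∈ Set.Ioc (0 : ℝ) 1, ∀ δ ∈ Set.Ioo (0 : ℝ) 1,
            ∃ m : ℕ,
              (m : ℝ) ≤ K * (((k : ℝ) + d₁ * d₂) * Real.log (2 + k + 1 / η) + Real.log (1 / δ))
                / (θ * ε) ^ 2 ∧
              SRLK.IsPACSRLK F (SRLK.domains k F η ε) A ((1 + θ) * ε) δ m := by
  classical
  refine ⟨1024, by norm_num, fun k d₁ d₂ hk F hF η ε hη hε => ?_⟩
  obtain ⟨hε0, hε1⟩ := hε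
  have hnet := fun X hX => SRLK.exists_net_kmeans (d₁ := d₁) (F := F) (ε := ε) (X := X) hk hη hX
  choose T hTcard hTnet using hnet
  obtain ⟨f₀, hf₀⟩ := hF
  -- The learner minimizes the empirical difference over the net of `X`.
  have hlearn : ∀ (X S : Finset (SRLK.Euc d₁)) (Y : Fin k → Finset (SRLK.Euc d₁)),
      ∃ g : F, ∀ hX : X ∈ SRLK.domains k F η ε, g ∈ T X hX ∧ ∀ g' ∈ T X hX,
        SRLK.clusteringDiff S Y (SRLK.restrict (SRLK.kmeans k X g.1) S) ≤
          SRLK.clusteringDiff S Y (SRLK.restrict (SRLK.kmeans k X g'.1) S) := by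
    intro X S Y
    by_cases hX : X ∈ SRLK.domains k F η ε
    · obtain ⟨t, ht, -⟩ := hTnet X hX ⟨f₀, hf₀⟩
      obtain ⟨g, hg, hmin⟩ := (T X hX).exists_min_image
        (fun g => SRLK.clusteringDiff S Y (SRLK.restrict (SRLK.kmeans k X g.1) S)) ⟨t, ht⟩
      exact ⟨g, fun _ => ⟨hg, hmin⟩⟩
    · exact ⟨⟨f₀, hf₀⟩, fun h => absurd h hX⟩
  choose A hA using hlearn
  refine ⟨fun X S Y => (A X S Y).1, fun θ hθ δ hδ => ?_⟩
  obtain ⟨hθ0, hθ1⟩ := hθ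
  obtain ⟨hδ0, hδ1⟩ := hδ
  have hηi : 0 < 1 / η := by positivity
  have hk1 : (1 : ℝ) ≤ k := by exact_mod_cast hk
  have hL : 1 ≤ Real.log (2 + k + 1 / η) := SRLK.one_le_log_of_three_le (by linarith)
  have hlogδ : 0 ≤ Real.log (1 / δ) := Real.log_nonneg (by rw [le_div_iff₀ hδ0]; linarith)
  set L := Real.log (2 + k + 1 / η) with hLdef
  set Q := ((k : ℝ) + d₁ * d₂) * L + Real.log (1 / δ) with hQ
  have hkQ : 1 ≤ (k : ℝ) * L := by nlinarith
  have hdL : 0 ≤ (d₁ : ℝ) * d₂ * L := by positivity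
  have hQ1 : 1 ≤ Q := by rw [hQ]; nlinarith
  have hw0 : 0 < (θ * ε) ^ 2 := by positivity
  have hw1 : (θ * ε) ^ 2 ≤ 1 := pow_le_one₀ (by positivity) (by nlinarith)
  have hB1 : 1 ≤ 512 * Q / (θ * ε) ^ 2 := by rw [le_div_iff₀ hw0]; linarith
  refine ⟨⌈512 * Q / (θ * ε) ^ 2⌉₊, ?_, fun X S Y => (A X S Y).2, ?_⟩
  · have h := (Nat.ceil_lt_add_one (show 0 ≤ 512 * Q / (θ * ε) ^ 2 by linarith)).le
    have e : 1024 * Q / (θ * ε) ^ 2 = 2 * (512 * Q / (θ * ε) ^ 2) := by ring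
    rw [e]
    linarith
  intro X hX C hC s hs
  have hBs : 512 * Q / (θ * ε) ^ 2 ≤ s := (Nat.le_ceil _).trans (by exact_mod_cast hs)
  have hspos : 0 < s := by
    have : (0 : ℝ) < s := by linarith
    exact_mod_cast this
  have hclust : ∀ g : F, SRLK.IsClustering X (SRLK.kmeans k X g.1) :=
    fun g => (hX.2 g.1 g.2).2.1
  have hdev := SRLK.card_filter_deviation_le hX.1 hC (T X hX)
    (D := fun g : F => SRLK.kmeans k X g.1) (fun g _ => hclust g) hspos
    (show 0 ≤ θ * ε / 2 by positivity)
  set Bad := (X.powersetCard s).filter fun S => ∃ g ∈ T X hX, θ * ε / 2 <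
    |SRLK.clusteringDiff S (SRLK.restrict C S) (SRLK.restrict (SRLK.kmeans k X g.1) S) -
      SRLK.clusteringDiff X C (SRLK.kmeans k X g.1)|
  have hsmall : ((T X hX).card : ℝ) * k.factorial * (2 * Real.exp (-(s * (θ * ε / 2) ^ 2 / 8))) ≤
      δ := by
    have hTpos : (0 : ℝ) < (T X hX).card := by
      obtain ⟨t, ht, -⟩ := hTnet X hX ⟨f₀, hf₀⟩
      exact_mod_cast Finset.card_pos.2 ⟨t, ht⟩
    have hfpos : (0 : ℝ) < k.factorial := by exact_mod_cast k.factorial_pos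
    rw [← Real.log_le_log_iff (by positivity) hδ0, Real.log_mul (by positivity) (by positivity),
      Real.log_mul (by positivity) (by positivity), Real.log_mul (by positivity) (by positivity),
      Real.log_exp]
    have h1 := hTcard X hX
    have h2 := SRLK.log_factorial_le k
    have h3 : (k : ℝ) * Real.log (2 + k) ≤ k * L := by
      refine mul_le_mul_of_nonneg_left ?_ (by positivity)
      exact Real.log_le_log (by positivity) (by linarith)
    have h4 : Real.log δ = -Real.log (1 / δ) := by rw [one_div, Real.log_inv, neg_neg]
    have h5 : 16 * Q ≤ s * (θ * ε / 2) ^ 2 / 8 := by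
      rw [div_le_iff₀ hw0] at hBs
      nlinarith
    have h6 := Real.log_two_lt_d9
    rw [hQ] at h5
    nlinarith
  have hgood : ((X.powersetCard s).filter fun S => S ∉ Bad) ⊆
      (X.powersetCard s).filter fun S =>
        SRLK.clusteringDiff X C (SRLK.kmeans k X (A X S (SRLK.restrict C S)).1) ≤
          (⨅ f : F, SRLK.clusteringDiff X C (SRLK.kmeans k X f.1)) + (1 + θ) * ε := by
    intro S hS
    obtain ⟨hSX, hSB⟩ := Finset.mem_filter.1 hS
    refine Finset.mem_filter.2 ⟨hSX, ?_⟩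
    obtain ⟨hmem, hmin⟩ := hA X S (SRLK.restrict C S) hX
    have h := SRLK.clusteringDiff_le_iInf_add ⟨f₀, hf₀⟩ (t := θ * ε / 2) (hTnet X hX)
      (fun g hg => not_lt.1 fun hlt => hSB (Finset.mem_filter.2 ⟨hSX, g, hg, hlt⟩)) hmem hmin
    linarith
  have hcompl : ((X.powersetCard s).card : ℝ) =
      Bad.card + ((X.powersetCard s).filter fun S => S ∉ Bad).card := by
    have := Finset.card_filter_add_card_filter_not (s := X.powersetCard s) (fun S => S ∈ Bad)
    rw [Finset.filter_mem_eq_inter, Finset.inter_eq_right.2 (Finset.filter_subset _ _)] at this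
    exact_mod_cast this.symm
  have hle : (((X.powersetCard s).filter fun S => S ∉ Bad).card : ℝ) ≤ _ :=
    Nat.cast_le.2 (Finset.card_le_card hgood)
  have hBad : (Bad.card : ℝ) ≤ δ * (X.powersetCard s).card := by
    have := mul_le_mul_of_nonneg_right hsmall (Nat.cast_nonneg (α := ℝ) (X.powersetCard s).card)
    linarith
  refine le_trans ?_ (hle.trans (le_of_eq ?_))
  · linarith
  · congr
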